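/- Let $\mathcal{T}$ be the smallest family of topological spaces that contains every compact subset of $\mathbb{R}^d$ for every $d \in \mathbb{N}$, is closed under finite Cartesian products (with the product topology), and contains $\mathcal{P}(X)$ whenever it contains $X$, where $\mathcal{P}(X)$ is the space of all Borel probability measures on $X$ with the topology of weak convergence. Every member of $\mathcal{T}$ is a compact metrizable space. Let $\sigma\colon\mathbb{R}\to\mathbb{R}$ be a continuous function that is not a polynomial. A *network* is a map $\mathbb{R}^n\to\mathbb{R}^m$ that consists of one non-linear and one linear layer, that is, a map with components $$x \mapsto \sum_{i=1}^{r} \alpha_{k,i}\,\sigma\Bigl(b_i+\sum_{j=1}^{n} w_{i,j}x_j\Bigr)\quad(1\le k\le m),\qquad r\in\mathbb{N},\ \alpha_{k,i},b_i,w_{i,j}\in\mathbb{R}.$$ For each $X \in \mathcal{T}$ with a given construction from compact sets by the operations above, HMill models on $X$ with $m$ outputs, and the functions $X\to\mathbb{R}^m$ which they represent, are defined recursively along this construction: - (array model) if $X$ is a compact subset of $\mathbb{R}^d$: $x \mapsto f(x)$, where $f\colon\mathbb{R}^d\to\mathbb{R}^m$ is a network; - (bag model) if $X=\mathcal{P}(Y)$: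 $p \mapsto f_B\bigl(\int_Y f_I\,\mathrm{d}p\bigr)$, where $f_I\colon Y\to\mathbb{R}^k$ is represented by an HMill model on $Y$, the integral (mean aggregation) is taken element-wise, and $f_B\colon\mathbb{R}^k\to\mathbb{R}^m$ is a network; - (product model) if $X=X_1\times\dots\times X_l$: $(x_1,\dots,x_l)\mapsto f\bigl([f_1(x_1)|\cdots|f_l(x_l)]\bigr)$, where $f_i\colon X_i\to\mathbb{R}^{k_i}$ is represented by an HMill model on $X_i$, the brackets denote concatenation, and $f\colon\mathbb{R}^{k_1+\dots+k_l}\to\mathbb{R}^m$ is a network. All these functions are continuous. For every $X\in\mathcal{T}$ and every such construction of $X$, the set of real-valued functions on $X$ represented by HMill models on $X$ with one output is dense in $C(X)$, the space of continuous real-valued functions on $X$ with the supremum norm. -/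

import Mathlib

open MeasureTheory TopologicalSpace
open scoped Polynomial

/-- The space `𝒫(X)` of all Borel probability measures on the topological space `X`,
with the topology of weak convergence. -/
noncomputable def borelProb (X : TopCat.{0}) : TopCat.{0} :=
  letI : MeasurableSpace X := borel X
  haveI : BorelSpace X := ⟨rfl⟩
  TopCat.of (ProbabilityMeasure X)

/-- The integral `∫_X f dp` of a function against a Borel probability measure `p ∈ 𝒫(X)`. -/
noncomputable def borelProb.integral {X : TopCat.{0}} (p : borelProb X) (f : X → ℝ) : ℝ :=
  letI : MeasurableSpace X := borel X
  ∫ x, f x ∂(ProbabilityMeasure.toMeasure p)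

/-- Schemata: the codes for the members of the smallest family of spaces that contains all compact
subsets of all `ℝᵈ`, and is closed under finite Cartesian products and under `X ↦ 𝒫(X)`. -/
inductive Schema : Type
  | array (d : ℕ) (K : Set (EuclideanSpace ℝ (Fin d))) (hK : IsCompact K) : Schema
  | bag (s : Schema) : Schema
  | product (l : ℕ) (s : Fin l → Schema) : Schema

/-- The space of all samples that follow a schema. A bag is a Borel probability measure on the
space of its instances. -/
noncomputable def Schema.space : Schema → TopCat.{0}
  | .array _ K _ => TopCat.of K
  | .bag s => borelProb s.space
  | .product l s => TopCat.of (∀ i : Fin l, (s i).space)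

/-- A family of spaces that contains all compact subsets of all `ℝᵈ`, and is closed under finite
Cartesian products and under `X ↦ 𝒫(X)`. -/
structure IsClosedFamily (T : Set TopCat.{0}) : Prop where
  compact_mem : ∀ (d : ℕ) (K : Set (EuclideanSpace ℝ (Fin d))), IsCompact K → TopCat.of K ∈ T
  product_mem : ∀ (l : ℕ) (X : Fin l → TopCat.{0}), (∀ i, X i ∈ T) → TopCat.of (∀ i, X i) ∈ T
  borelProb_mem : ∀ X ∈ T, borelProb X ∈ T

/-- The spaces of the schemata form the smallest such family. -/
theorem Schema.isLeast_range_space : IsLeast {T | IsClosedFamily T} (Set.range Schema.space) := by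
  refine ⟨⟨fun d K hK => ⟨.array d K hK, rfl⟩, fun l X hX => ?_, ?_⟩, ?_⟩
  · choose s hs using hX
    obtain rfl : (fun i => (s i).space) = X := funext hs
    exact ⟨.product l s, rfl⟩
  · rintro _ ⟨s, rfl⟩
    exact ⟨.bag s, rfl⟩
  · rintro T hT _ ⟨s, rfl⟩
    induction s with
    | array d K hK => exact hT.compact_mem d K hK
    | bag s ih => exact hT.borelProb_mem _ ih
    | product l s ih => exact hT.product_mem l _ ih

/-- The parameters of a stack of one non-linear and one linear neural network layer, with `m`
outputs and with inputs indexed by `ι`. -/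
structure Network (ι : Type) (m : ℕ) : Type where
  width : ℕ
  weight : Fin width → ι → ℝ
  bias : Fin width → ℝ
  coeff : Fin m → Fin width → ℝ

/-- The function `ℝ^ι → ℝ^m` with components
`x ↦ ∑ᵢ αₖᵢ σ (bᵢ + ∑ⱼ wᵢⱼ xⱼ)` that a network computes with activation function `σ`. -/
def Network.eval {ι : Type} [Fintype ι] {m : ℕ} (N : Network ι m) (σ : C(ℝ, ℝ))
    (x : ι → ℝ) : Fin m → ℝ :=
  fun k => ∑ i, N.coeff k i * σ (N.bias i + ∑ j, N.weight i j * x j)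

/-- HMill models with `m` outputs for the samples of a given schema: trees of array model nodes,
bag model nodes (instance model, mean aggregation, bag mapping) and product model nodes
(submodels, and a mapping of the concatenation of their outputs), all of whose mappings between
Euclidean spaces are neural networks. -/
inductive HMillModel : Schema → ℕ → Type
  | array {d : ℕ} {K : Set (EuclideanSpace ℝ (Fin d))} {hK : IsCompact K} {m : ℕ}
      (f : Network (Fin d) m) : HMillModel (.array d K hK) m
  | bag {s : Schema} {k m : ℕ} (fI : HMillModel s k) (fB : Network (Fin k) m) :
      HMillModel (.bag s) m
  | product {l : ℕ} {s : Fin l → Schema} {k : Fin l → ℕ} {m : ℕ}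
      (fs : ∀ i, HMillModel (s i) (k i)) (f : Network ((i : Fin l) × Fin (k i)) m) :
      HMillModel (.product l s) m

/-- Evaluation of an HMill model on a sample; the activation function `σ` is used in all layers. -/
noncomputable def HMillModel.eval (σ : C(ℝ, ℝ)) :
    {s : Schema} → {m : ℕ} → HMillModel s m → s.space → Fin m → ℝ
  | .array _ K _, _, .array f => fun (x : K) => f.eval σ (fun j => x.1 j)
  | .bag s, _, .bag fI fB => fun (p : borelProb s.space) =>
      fB.eval σ (fun j => borelProb.integral p (fun x => fI.eval σ x j))
  | .product l s, _, .product fs f => fun (x : ∀ i : Fin l, (s i).space) =>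
      f.eval σ (fun j => (fs j.1).eval σ (x j.1) j.2)

theorem Schema.compact_metrizable (s : Schema) :
    CompactSpace s.space ∧ MetrizableSpace s.space := by
  induction s with
  | array d K hK =>
    exact ⟨isCompact_iff_compactSpace.mp hK, (inferInstance : MetrizableSpace K)⟩
  | bag s ih =>
    obtain ⟨h1, h2⟩ := ih
    let _ : MeasurableSpace s.space := borel s.space
    have _ : BorelSpace s.space := ⟨rfl⟩
    let _ : MetricSpace s.space := metrizableSpaceMetric s.space
    exact ⟨(inferInstance : CompactSpace (ProbabilityMeasure s.space)),
      (inferInstance : MetrizableSpace (ProbabilityMeasure s.space))⟩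
  | product l s ih =>
    have h1 := fun i => (ih i).1
    have h2 := fun i => (ih i).2
    exact ⟨(inferInstance : CompactSpace (∀ i, (s i).space)),
      (inferInstance : MetrizableSpace (∀ i, (s i).space))⟩

instance Schema.instCompactSpace (s : Schema) : CompactSpace s.space := s.compact_metrizable.1

instance Schema.instMetrizableSpace (s : Schema) : MetrizableSpace s.space :=
  s.compact_metrizable.2

theorem Network.continuous_eval {ι : Type} [Fintype ι] {m : ℕ} (N : Network ι m) (σ : C(ℝ, ℝ)) :
    Continuous (N.eval σ) := by
  unfold Network.eval
  fun_prop

theorem borelProb.continuous_integral {X : TopCat.{0}} [CompactSpace X] (f : C(X, ℝ)) :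
    Continuous (fun p : borelProb X => borelProb.integral p f) := by
  let _ : MeasurableSpace X := borel X
  have _ : BorelSpace X := ⟨rfl⟩
  exact ProbabilityMeasure.continuous_integral_continuousMap f

theorem HMillModel.continuous_eval (σ : C(ℝ, ℝ)) {s : Schema} {m : ℕ} (M : HMillModel s m) :
    Continuous (M.eval σ) := by
  induction M with
  | array f =>
    exact (f.continuous_eval σ).comp (by fun_prop)
  | bag fI fB ih =>
    exact (fB.continuous_eval σ).comp (continuous_pi fun j =>
      borelProb.continuous_integral ⟨fun x => fI.eval σ x j, (continuous_apply j).comp ih⟩)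
  | product fs f ih =>
    exact (f.continuous_eval σ).comp (continuous_pi fun j =>
      (continuous_apply j.2).comp ((ih j.1).comp (continuous_apply j.1)))

/-- The element of `C(X)` represented by an HMill model with one real output. -/
noncomputable def HMillModel.realize (σ : C(ℝ, ℝ)) {s : Schema} (M : HMillModel s 1) :
    C(s.space, ℝ) :=
  ⟨fun x => M.eval σ x 0, (continuous_apply 0).comp (M.continuous_eval σ)⟩

open Filter Topology

/-! ### Mollifications with non-vanishing derivatives -/

section Polynomial

/-! Induction on the schema. At every node a one-neuron outer network yields `σ ∘ (v + b)`, where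
`v` runs over a linear space `V`: linear functionals on an array, integrals of realizable functions
on a bag, sums of realizable functions of the coordinates on a product. Density at the children
makes `V` separate points.

It remains to see that such superpositions span a dense space. Their closed span also contains `ρ ∘
(v + b)` for every mollification `ρ` of `σ`. Differentiating in directions `v₁, …, vₙ` at `0` gives
`ρ⁽ⁿ⁾(b) v₁ ⋯ vₙ`, and since `σ` is not a polynomial, some `ρ` and `b` make the factor nonzero. So
the closed span contains the algebra generated by `V`, and Stone–Weierstrass applies. -/

theorem exists_polynomial_eval_eq_of_iteratedDeriv_eq_zero {f : ℝ → ℝ} {n : ℕ}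
    (hf : ContDiff ℝ n f) (h : ∀ x, iteratedDeriv n f x = 0) :
    ∃ P : ℝ[X], P.degree < n ∧ ∀ x, f x = P.eval x := by
  obtain _ | n := n
  · exact ⟨0, by simp, by simpa using h⟩
  refine ⟨∑ k ∈ Finset.range (n + 1),
    Polynomial.C (iteratedDeriv k f 0 / k.factorial) * Polynomial.X ^ k, ?_, fun x => ?_⟩
  · refine (Polynomial.degree_sum_le _ _).trans_lt ((Finset.sup_lt_iff (WithBot.bot_lt_coe _)).2
      fun k hk => (Polynomial.degree_C_mul_X_pow_le _ _).trans_lt ?_)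
    exact_mod_cast Finset.mem_range.1 hk
  · have hd (k : ℕ) (hk : k ≤ n) : ContDiff ℝ k f :=
      hf.of_le (by exact_mod_cast hk.trans n.le_succ)
    rcases eq_or_ne 0 x with rfl | hx
    · rw [Polynomial.eval_finsetSum, Finset.sum_range_succ']
      simp
    · obtain ⟨y, -, hy⟩ := taylor_mean_remainder_lagrange_iteratedDeriv hx
        (n := n) (by exact_mod_cast hf.contDiffOn)
      rw [h, zero_mul, zero_div, sub_eq_zero] at hy
      rw [hy, taylor_within_apply, Polynomial.eval_finsetSum]
      refine Finset.sum_congr rfl fun k hk => ?_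
      rw [iteratedDerivWithin_eq_iteratedDeriv (uniqueDiffOn_uIcc hx)
        (hd k (Nat.lt_succ_iff.1 (Finset.mem_range.1 hk))).contDiffAt Set.left_mem_uIcc]
      simp
      ring

/-- A pointwise limit of polynomial functions of bounded degree is a polynomial function. -/
theorem exists_polynomial_eval_eq_of_tendsto {ι : Type*} {l : Filter ι} [l.NeBot] {n : ℕ}
    {P : ι → ℝ[X]} (hP : ∀ i, (P i).degree < n) {f : ℝ → ℝ}
    (h : ∀ x, Tendsto (fun i => (P i).eval x) l (𝓝 (f x))) :
    ∃ Q : ℝ[X], ∀ x, f x = Q.eval x := by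
  -- Degree below `n` makes each `P i` the interpolant of its values at `0, …, n - 1`, and these
  -- values converge.
  refine ⟨Lagrange.interpolate (Finset.range n) (fun k : ℕ => (k : ℝ)) (fun k => f k),
    fun x => tendsto_nhds_unique (h x) ?_⟩
  have hi (i : ι) : P i = Lagrange.interpolate (Finset.range n) (fun k : ℕ => (k : ℝ))
      (fun k => (P i).eval (k : ℝ)) :=
    Lagrange.eq_interpolate (Nat.cast_injective.injOn) (by simpa using hP i)
  rw [funext fun i => congrArg (Polynomial.eval x) (hi i)]
  simp only [Lagrange.interpolate_apply, Polynomial.eval_finsetSum, Polynomial.eval_mul,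
    Polynomial.eval_C]
  exact tendsto_finsetSum _ fun k _ => (h k).mul_const _

/-- Some mollification of a continuous non-polynomial function has a nonzero `n`-th derivative. -/
theorem exists_iteratedDeriv_convolution_ne_zero {σ : ℝ → ℝ} (hc : Continuous σ)
    (hσ : ¬ ∃ P : ℝ[X], ∀ t : ℝ, σ t = P.eval t) (n : ℕ) :
    ∃ φ : ContDiffBump (0 : ℝ), ∃ b : ℝ,
      iteratedDeriv n (convolution (φ.normed volume) σ (.lsmul ℝ ℝ) volume) b ≠ 0 := by
  by_contra! h
  -- The supports shrink to `0`, so the mollifications, all polynomials of degree below `n`, tend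
  -- pointwise to `σ`.
  let φ (k : ℕ) : ContDiffBump (0 : ℝ) :=
    ⟨1 / (k + 1) / 2, 1 / (k + 1), by positivity, half_lt_self (by positivity)⟩
  have hφ (k : ℕ) := exists_polynomial_eval_eq_of_iteratedDeriv_eq_zero
    ((φ k).hasCompactSupport_normed.contDiff_convolution_left (.lsmul ℝ ℝ)
      (φ k).contDiff_normed hc.locallyIntegrable) (h (φ k))
  choose P hP hPe using hφ
  refine hσ (exists_polynomial_eval_eq_of_tendsto (l := atTop) hP fun x => ?_)
  simp only [← hPe]
  exact ContDiffBump.convolution_tendsto_right_of_continuous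
    tendsto_one_div_add_atTop_nhds_zero_nat hc x

end Polynomial

/-! ### Universal approximation from a separating linear space -/

section Density

variable {X : Type*} [TopologicalSpace X]

/-- A closed submodule is complete, so the integral can be taken inside it; the isometric inclusion
commutes with it even without integrability. -/
theorem Submodule.integral_mem_of_isClosed {E α : Type*} [NormedAddCommGroup E] [NormedSpace ℝ E]
    [CompleteSpace E] [MeasurableSpace α] {μ : Measure α} (M : Submodule ℝ E)
    (hM : IsClosed (M : Set E)) {f : α → E} (h : ∀ a, f a ∈ M) :
    ∫ a, f a ∂μ ∈ M := by
  have := hM.completeSpace_coe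
  exact (M.subtypeₗᵢ.integral_comp_comm fun a => ⟨f a, h a⟩) ▸ Subtype.property _

/-- Differentiation of superpositions `g ∘ (u + s v)` with respect to `s`, at `s = 0`. -/
theorem mul_comp_deriv_mem [FirstCountableTopology X] {M : Submodule ℝ C(X, ℝ)}
    (hM : IsClosed (M : Set C(X, ℝ))) {g g' : C(ℝ, ℝ)} (hg : ∀ t, HasDerivAt g (g' t) t)
    (p u v : C(X, ℝ)) (h : ∀ s : ℝ, p * g.comp (u + s • v) ∈ M) :
    v * p * g'.comp u ∈ M := by
  -- This integral is the difference quotient for `s ≠ 0` and the derivative at `s = 0`. Joint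
  -- continuity and currying give convergence in `C(X, ℝ)` without explicit estimates.
  have hc : Continuous fun q : ℝ × X =>
      ∫ t in (0 : ℝ)..1, v q.2 * p q.2 * g' (u q.2 + t * (q.1 * v q.2)) :=
    intervalIntegral.continuous_parametric_intervalIntegral_of_continuous'
      (by simp only [Function.uncurry_def]; fun_prop) 0 1
  let H : C(ℝ, C(X, ℝ)) := ContinuousMap.curry ⟨_, hc⟩
  have h0 : H 0 = v * p * g'.comp u := by
    ext x
    simp [H]
  have hs (s : ℝ) (hs : s ≠ 0) :
        H s = s⁻¹ • (p * g.comp (u + s • v) - p * g.comp (u + (0 : ℝ) • v)) := by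
    ext x
    have hd (t : ℝ) : HasDerivAt (fun t => g (u x + t * (s * v x)))
        (g' (u x + t * (s * v x)) * (s * v x)) t :=
      (hg _).comp t (((hasDerivAt_id t).mul_const (s * v x)).const_add (u x) |>.congr_deriv (by simp))
    have hi := intervalIntegral.integral_eq_sub_of_hasDerivAt (a := 0) (b := 1)
      (fun t _ => hd t) (Continuous.intervalIntegrable (by fun_prop) _ _)
    simp only [intervalIntegral.integral_mul_const, one_mul, zero_mul, add_zero] at hi
    simp only [H, ContinuousMap.curry_apply, ContinuousMap.coe_mk,
      intervalIntegral.integral_const_mul]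
    simp
    rw [← mul_sub, ← hi]
    generalize ∫ t in (0 : ℝ)..1, g' (u x + t * (s * v x)) = I
    field_simp
  rw [← h0]
  have ht : Tendsto H (𝓝[≠] 0) (𝓝 (H 0)) := (H.continuous.tendsto 0).mono_left nhdsWithin_le_nhds
  refine hM.mem_of_tendsto ht (eventually_nhdsWithin_of_forall fun s hs0 => ?_)
  rw [hs s hs0]
  exact M.smul_mem _ (M.sub_mem (h s) (h 0))

/-- Each factor `v` costs one derivative along `u + s • v`, which stays in `V`; hence `u` must
remain arbitrary in the induction. -/
theorem list_prod_mul_comp_iteratedDeriv_mem [FirstCountableTopology X] {M : Submodule ℝ C(X, ℝ)}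
    (hM : IsClosed (M : Set C(X, ℝ))) {V : Submodule ℝ C(X, ℝ)} {ρ : ℝ → ℝ}
    (hρ : ContDiff ℝ (⊤ : ℕ∞) ρ)
    (h : ∀ v ∈ V, ∀ b : ℝ, (ContinuousMap.mk ρ hρ.continuous).comp (v + .const X b) ∈ M)
    (l : List C(X, ℝ)) (hl : ∀ v ∈ l, v ∈ V) :
    ∀ u ∈ V, ∀ b : ℝ, l.prod * (ContinuousMap.mk (iteratedDeriv l.length ρ)
      (hρ.continuous_iteratedDeriv _ (by exact_mod_cast le_top))).comp (u + .const X b) ∈ M := by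
  induction l with
  | nil => simpa using h
  | cons v l ih =>
    intro u hu b
    rw [List.prod_cons]
    refine mul_comp_deriv_mem hM (g := ⟨iteratedDeriv l.length ρ,
      hρ.continuous_iteratedDeriv _ (by exact_mod_cast le_top)⟩) (fun t => ?_) _ _ v fun s => ?_
    · simp only [ContinuousMap.coe_mk, List.length_cons, iteratedDeriv_succ]
      exact ((hρ.differentiable_iteratedDeriv _
        (by exact_mod_cast WithTop.coe_lt_top _)) t).hasDerivAt
    · rw [add_right_comm]
      exact ih (fun w hw => hl w (List.mem_cons_of_mem _ hw)) _
        (V.add_mem hu (V.smul_mem s (hl v List.mem_cons_self))) b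

variable [CompactSpace X]

/-- Superpositions of a mollified activation function are limits of superpositions of the
activation function. -/
theorem convolution_comp_mem {M : Submodule ℝ C(X, ℝ)} (hM : IsClosed (M : Set C(X, ℝ)))
    {σ : C(ℝ, ℝ)} {φ : C(ℝ, ℝ)} (hφ : HasCompactSupport φ) {v : C(X, ℝ)}
    (hv : ∀ b : ℝ, σ.comp (v + .const X b) ∈ M) {ρ : C(ℝ, ℝ)}
    (hρ : ∀ t, ρ t = convolution φ σ (.lsmul ℝ ℝ) volume t) : ρ.comp v ∈ M := by
  -- The convolution, read as a `C(X, ℝ)`-valued integral of elements of `M`.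
  let F (t : ℝ) : C(X, ℝ) := φ t • σ.comp (v + .const X (-t))
  have hF : Continuous F := by
    refine ContinuousMap.continuous_of_continuous_uncurry _ ?_
    simp only [F, Function.uncurry_def]
    dsimp
    fun_prop
  have hFi : Integrable F := by
    refine hF.integrable_of_hasCompactSupport (hφ.mono fun t ht => ?_)
    contrapose! ht
    simp [F, Function.notMem_support.1 ht]
  have : ρ.comp v = ∫ t, F t := by
    ext x
    rw [ContinuousMap.integral_apply hFi]
    simp [hρ, F, convolution, sub_eq_add_neg]
  rw [this]
  exact M.integral_mem_of_isClosed hM fun t => M.smul_mem _ (hv _)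

/-- **Universal approximation theorem**: if a linear space `V` of continuous functions on a compact
space separates points, then the linear combinations of the functions `σ ∘ (v + b)` with `v ∈ V`
and `b ∈ ℝ` are dense, for every continuous function `σ` that is not a polynomial. -/
theorem Submodule.topologicalClosure_eq_top_of_comp_mem [FirstCountableTopology X]
    {σ : C(ℝ, ℝ)} (hσ : ¬ ∃ P : ℝ[X], ∀ t : ℝ, σ t = P.eval t) {V : Submodule ℝ C(X, ℝ)}
    (hV : ∀ x y : X, x ≠ y → ∃ v ∈ V, v x ≠ v y) {R : Submodule ℝ C(X, ℝ)}
    (hR : ∀ v ∈ V, ∀ b : ℝ, σ.comp (v + .const X b) ∈ R) : R.topologicalClosure = ⊤ := by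
  have hM := R.isClosed_topologicalClosure
  have hprod (l : List C(X, ℝ)) (hl : ∀ v ∈ l, v ∈ V) : l.prod ∈ R.topologicalClosure := by
    -- The mollifier may depend on the number of factors. At `u = 0` the derivative term is a
    -- nonzero constant.
    obtain ⟨φ, b, hb⟩ := exists_iteratedDeriv_convolution_ne_zero σ.continuous hσ l.length
    have hρ : ContDiff ℝ (⊤ : ℕ∞) (convolution (φ.normed volume) σ (.lsmul ℝ ℝ) volume) :=
      φ.hasCompactSupport_normed.contDiff_convolution_left _ φ.contDiff_normed
        σ.continuous.locallyIntegrable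
    have := list_prod_mul_comp_iteratedDeriv_mem hM hρ (fun v hv c =>
      convolution_comp_mem hM (φ := ⟨φ.normed volume, φ.continuous_normed⟩)
        (φ.hasCompactSupport_normed (μ := volume))
        (fun b => R.le_topologicalClosure ?_) fun t => rfl) l hl 0 V.zero_mem b
    · refine (Submodule.smul_mem_iff _ hb).1 ?_
      convert this using 1
      ext x
      simp [mul_comm]
    · rw [add_assoc]
      exact hR v hv (c + b)
  let A := Algebra.adjoin ℝ (V : Set C(X, ℝ))
  have hA : A.topologicalClosure = ⊤ := by
    refine ContinuousMap.subalgebra_topologicalClosure_eq_top_of_separatesPoints A fun x y hxy => ?_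
    obtain ⟨v, hv, hne⟩ := hV x y hxy
    exact ⟨v, ⟨v, Algebra.subset_adjoin hv, rfl⟩, hne⟩
  have hle : Subalgebra.toSubmodule A ≤ R.topologicalClosure := by
    rw [Algebra.adjoin_eq_span, Submodule.span_le]
    intro f hf
    obtain ⟨l, hl, rfl⟩ := Submonoid.exists_list_of_mem_closure hf
    exact hprod l hl
  refine eq_top_iff.2 fun f _ => ?_
  have hf : f ∈ A.topologicalClosure := hA ▸ Algebra.mem_top
  exact closure_minimal (s := (A : Set C(X, ℝ))) hle hM hf

end Density

/-! ### Linear operations on networks -/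

namespace Network

variable {ι κ : Type} [Fintype ι] [Fintype κ] {m n : ℕ}

/-- The network with a single neuron and a single output. -/
def neuron (w : ι → ℝ) (b : ℝ) : Network ι 1 := ⟨1, fun _ => w, fun _ => b, fun _ _ => 1⟩

theorem neuron_eval (w : ι → ℝ) (b : ℝ) (σ : C(ℝ, ℝ)) (x : ι → ℝ) (k : Fin 1) :
    (neuron w b).eval σ x k = σ (b + ∑ j, w j * x j) := by
  refine (Fin.sum_univ_one _).trans ?_
  simp [neuron]

/-- Precomposition of a network with a linear map. -/
def comap [DecidableEq κ] (N : Network ι m) (L : (κ → ℝ) →ₗ[ℝ] ι → ℝ) : Network κ m :=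
  ⟨N.width, fun i j => ∑ a, N.weight i a * L (Pi.single j 1) a, N.bias, N.coeff⟩

theorem comap_eval [DecidableEq κ] (N : Network ι m) (L : (κ → ℝ) →ₗ[ℝ] ι → ℝ) (σ : C(ℝ, ℝ))
    (x : κ → ℝ) : (N.comap L).eval σ x = N.eval σ (L x) := by
  have h (a : ι) : L x a = ∑ j, L (Pi.single j 1) a * x j := by
    conv_lhs => rw [← Finset.univ_sum_single x, map_sum, Finset.sum_apply]
    refine Finset.sum_congr rfl fun j _ => ?_
    have h := congrFun (L.map_smul (x j) (Pi.single j 1)) a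
    rwa [← Pi.single_smul, smul_eq_mul, mul_one, Pi.smul_apply, smul_eq_mul, mul_comm] at h
  funext k
  simp only [eval, comap, h, Finset.sum_mul, Finset.mul_sum]
  refine Finset.sum_congr rfl fun i _ => ?_
  rw [Finset.sum_comm]
  simp only [mul_assoc]

/-- Postcomposition of a network with a linear map. -/
def map (N : Network ι m) (L : (Fin m → ℝ) →ₗ[ℝ] Fin n → ℝ) : Network ι n :=
  ⟨N.width, N.weight, N.bias, fun k i => L (fun a => N.coeff a i) k⟩

theorem map_eval (N : Network ι m) (L : (Fin m → ℝ) →ₗ[ℝ] Fin n → ℝ) (σ : C(ℝ, ℝ))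
    (x : ι → ℝ) : (N.map L).eval σ x = L (N.eval σ x) := by
  have h : N.eval σ x = ∑ i, σ (N.bias i + ∑ j, N.weight i j * x j) • fun a => N.coeff a i := by
    funext k
    simp [eval, mul_comm]
  funext k
  rw [h, map_sum, Finset.sum_apply]
  refine Finset.sum_congr rfl fun i _ => ?_
  rw [map_smul, Pi.smul_apply, smul_eq_mul, mul_comm]
  rfl

/-- Juxtaposition of two networks with the same inputs. -/
def append (N : Network ι m) (N' : Network ι n) : Network ι (m + n) :=
  ⟨N.width + N'.width, Fin.append N.weight N'.weight, Fin.append N.bias N'.bias,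
    Fin.append (fun k => Fin.append (N.coeff k) 0) (fun k => Fin.append 0 (N'.coeff k))⟩

theorem append_eval (N : Network ι m) (N' : Network ι n) (σ : C(ℝ, ℝ)) (x : ι → ℝ) :
    (N.append N').eval σ x = Fin.append (N.eval σ x) (N'.eval σ x) := by
  funext k
  refine Fin.addCases (fun k => ?_) (fun k => ?_) k <;>
    refine (Fin.sum_univ_add _).trans ?_ <;> simp [eval, append]

end Network

/-! ### Realizable functions form a linear space -/

namespace HMillModel

variable {σ : C(ℝ, ℝ)} {s : Schema} {m n : ℕ}

/-- The last layer is linear, so it absorbs `L`. -/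
theorem exists_eval_eq_map (M : HMillModel s m) (L : (Fin m → ℝ) →ₗ[ℝ] Fin n → ℝ) :
    ∃ P : HMillModel s n, ∀ x, P.eval σ x = L (M.eval σ x) := by
  cases M with
  | array f => exact ⟨.array (f.map L), fun x => f.map_eval L σ _⟩
  | bag fI fB => exact ⟨.bag fI (fB.map L), fun x => fB.map_eval L σ _⟩
  | product fs f => exact ⟨.product fs (f.map L), fun x => f.map_eval L σ _⟩

/-- A node has only one submodel per child, so the submodels are joined recursively and each outer
network reads its own block. -/
theorem exists_eval_eq_append (M : HMillModel s m) (N : HMillModel s n) :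
    ∃ P : HMillModel s (m + n), ∀ x, P.eval σ x = Fin.append (M.eval σ x) (N.eval σ x) := by
  induction s generalizing m n with
  | array d K hK =>
    cases M with | array f =>
    cases N with | array g =>
    exact ⟨.array (f.append g), fun x => f.append_eval g σ _⟩
  | bag s ih =>
    cases M with | @bag _ k _ fI fB =>
    cases N with | @bag _ k' _ gI gB =>
    obtain ⟨P, hP⟩ := ih fI gI
    refine ⟨.bag P ((fB.comap (LinearMap.funLeft ℝ ℝ (Fin.castAdd k'))).append
      (gB.comap (LinearMap.funLeft ℝ ℝ (Fin.natAdd k)))), fun p => ?_⟩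
    refine (Network.append_eval _ _ σ _).trans ?_
    rw [Network.comap_eval, Network.comap_eval]
    simp [eval, LinearMap.funLeft, Function.comp_def, hP]
    rfl
  | product l s ih =>
    cases M with | @product _ _ k _ fs f =>
    cases N with | @product _ _ k' _ gs g =>
    choose P hP using fun i => ih i (fs i) (gs i)
    refine ⟨.product P
      ((f.comap (LinearMap.funLeft ℝ ℝ fun j => ⟨j.1, Fin.castAdd (k' j.1) j.2⟩)).append
        (g.comap (LinearMap.funLeft ℝ ℝ fun j => ⟨j.1, Fin.natAdd (k j.1) j.2⟩))), fun x => ?_⟩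
    refine (Network.append_eval _ _ σ _).trans ?_
    rw [Network.comap_eval, Network.comap_eval]
    simp [eval, LinearMap.funLeft, Function.comp_def, hP]
    rfl

instance instInhabited : (s : Schema) → (m : ℕ) → Inhabited (HMillModel s m)
  | .array _ _ _, _ => ⟨.array ⟨0, 0, 0, 0⟩⟩
  | .bag s, _ => ⟨.bag (instInhabited s 0).default ⟨0, 0, 0, 0⟩⟩
  | .product _ s, _ => ⟨.product (k := 0) (fun i => (instInhabited (s i) 0).default) ⟨0, 0, 0, 0⟩⟩

variable (σ s) in
/-- The linear space of the real functions that are represented by HMill models. -/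
noncomputable def realizable : Submodule ℝ C(s.space, ℝ) where
  carrier := Set.range fun M : HMillModel s 1 => M.realize σ
  add_mem' := by
    rintro _ _ ⟨M, rfl⟩ ⟨N, rfl⟩
    obtain ⟨P, hP⟩ := M.exists_eval_eq_append (σ := σ) N
    obtain ⟨Q, hQ⟩ := P.exists_eval_eq_map (σ := σ)
      (LinearMap.funLeft ℝ ℝ (Fin.castAdd 1) + LinearMap.funLeft ℝ ℝ (Fin.natAdd 1))
    refine ⟨Q, ContinuousMap.ext fun x => (congrFun (hQ x) 0).trans ?_⟩
    rw [hP, LinearMap.add_apply, Pi.add_apply, LinearMap.funLeft_apply,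
      LinearMap.funLeft_apply, Fin.append_left, Fin.append_right]
    rfl
  zero_mem' := by
    obtain ⟨Q, hQ⟩ := (default : HMillModel s 0).exists_eval_eq_map (σ := σ) (n := 1) 0
    exact ⟨Q, ContinuousMap.ext fun x => congrFun (hQ x) 0⟩
  smul_mem' c := by
    rintro _ ⟨M, rfl⟩
    obtain ⟨Q, hQ⟩ := M.exists_eval_eq_map (σ := σ) (c • LinearMap.id)
    exact ⟨Q, ContinuousMap.ext fun x => congrFun (hQ x) 0⟩

end HMillModel

/-! ### Separation of points and the induction -/

/-- Integration against Borel probability measures, as a linear map to the continuous functions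
of the measure. -/
noncomputable def borelProb.integralₗ (X : TopCat.{0}) [CompactSpace X] :
    C(X, ℝ) →ₗ[ℝ] C(borelProb X, ℝ) :=
  letI : MeasurableSpace X := borel X
  haveI : BorelSpace X := ⟨rfl⟩
  { toFun f := ⟨fun p => borelProb.integral p f, borelProb.continuous_integral f⟩
    map_add' f g := ContinuousMap.ext fun _ : ProbabilityMeasure X =>
      integral_add (f.continuous.integrable_of_hasCompactSupport (.of_compactSpace _))
        (g.continuous.integrable_of_hasCompactSupport (.of_compactSpace _))
    map_smul' c _ := ContinuousMap.ext fun _ : ProbabilityMeasure X => integral_const_mul c _ }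

/-- Borel probability measures on a compact metrizable space are separated by the integrals of the
functions in any dense set. -/
theorem borelProb.exists_integral_ne {X : TopCat.{0}} [CompactSpace X] [MetrizableSpace X]
    {D : Set C(X, ℝ)} (hD : Dense D) {p q : borelProb X} (hpq : p ≠ q) :
    ∃ f ∈ D, borelProb.integral p f ≠ borelProb.integral q f := by
  let _ : MeasurableSpace X := borel X
  have : BorelSpace X := ⟨rfl⟩
  have hprob (r : borelProb X) : IsProbabilityMeasure (ProbabilityMeasure.toMeasure r) :=
    Subtype.property (α := Measure X) r
  by_contra! h
  -- Total mass one bounds the integral by the sup norm, so equality on `D` extends to all of `C(X,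
  -- ℝ)`.
  have hc (r : borelProb X) : Continuous fun f : C(X, ℝ) => borelProb.integral r f := by
    refine AddMonoidHomClass.continuous_of_bound
      ((ContinuousMap.evalCLM ℝ r).toLinearMap ∘ₗ borelProb.integralₗ X) 1 fun f => ?_
    have := hprob r
    refine (norm_integral_le_of_norm_le_const (.of_forall f.norm_coe_le_norm)).trans ?_
    rw [probReal_univ, mul_comm]
  have h' (f : C(X, ℝ)) : borelProb.integral p f = borelProb.integral q f :=
    congrFun (Continuous.ext_on hD (hc p) (hc q) h) f
  refine hpq (Subtype.ext
    (show ProbabilityMeasure.toMeasure p = ProbabilityMeasure.toMeasure q from ?_))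
  have := hprob p
  have := hprob q
  exact ext_of_forall_integral_eq_of_IsFiniteMeasure fun f => h' f.toContinuousMap

/-- Otherwise equality would extend from `D` to the distance to `y`. -/
theorem ContinuousMap.exists_apply_ne_of_dense {X : Type*} [TopologicalSpace X] [MetrizableSpace X]
    {D : Set C(X, ℝ)} (hD : Dense D) {x y : X} (hxy : x ≠ y) : ∃ f ∈ D, f x ≠ f y := by
  by_contra! h
  let _ := metrizableSpaceMetric X
  have := congrFun (Continuous.ext_on hD (continuous_eval_const x) (continuous_eval_const y) h)
    ⟨fun z => dist z y, by fun_prop⟩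
  exact hxy (by simpa using this)

theorem mainTheorem1 (σ : C(ℝ, ℝ)) (hσ : ¬ ∃ P : ℝ[X], ∀ t : ℝ, σ t = P.eval t) (s : Schema) :
    Dense (Set.range (fun M : HMillModel s 1 => M.realize σ)) := by
  suffices h : (HMillModel.realizable σ s).topologicalClosure = ⊤ from
    Submodule.dense_iff_topologicalClosure_eq_top.2 h
  induction s with
  | array d K hK =>
    have := isCompact_iff_compactSpace.1 hK
    let T : (Fin d → ℝ) →ₗ[ℝ] C(K, ℝ) :=
      { toFun w := ⟨fun x => ∑ j, w j * x.1 j, by fun_prop⟩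
        map_add' v w := by ext x; simp [add_mul, Finset.sum_add_distrib]
        map_smul' c w := by ext x; simp [mul_assoc, Finset.mul_sum] }
    refine Submodule.topologicalClosure_eq_top_of_comp_mem hσ (V := LinearMap.range T)
      (fun x y hxy => ?_) ?_
    · obtain ⟨j, hj⟩ : ∃ j, x.1 j ≠ y.1 j := by
        by_contra! h
        exact hxy (Subtype.ext (PiLp.ext h))
      exact ⟨_, ⟨Pi.single j 1, rfl⟩, by simpa [T, Pi.single_apply] using hj⟩
    · rintro _ ⟨w, rfl⟩ b
      refine ⟨.array (.neuron w b), ContinuousMap.ext fun x => ?_⟩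
      exact (Network.neuron_eval w b σ _ 0).trans (congrArg σ (add_comm _ _))
  | bag s ih =>
    have : CompactSpace (borelProb s.space) := (Schema.bag s).instCompactSpace
    have : MetrizableSpace (borelProb s.space) := (Schema.bag s).instMetrizableSpace
    refine Submodule.topologicalClosure_eq_top_of_comp_mem hσ
      (V := (HMillModel.realizable σ s).map (borelProb.integralₗ s.space)) (fun p q hpq => ?_) ?_
    · obtain ⟨f, hf, hne⟩ := borelProb.exists_integral_ne
        (Submodule.dense_iff_topologicalClosure_eq_top.2 ih) hpq
      exact ⟨_, Submodule.mem_map_of_mem hf, hne⟩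
    · rintro _ ⟨_, ⟨M, rfl⟩, rfl⟩ b
      -- Weight `1` suffices: scalars are already absorbed in `M`.
      refine ⟨.bag M (.neuron 1 b), ContinuousMap.ext fun p => ?_⟩
      refine (Network.neuron_eval 1 b σ _ 0).trans (congrArg σ ?_)
      simp only [Pi.one_apply, one_mul, Finset.univ_unique, Finset.sum_singleton]
      exact add_comm _ _
  | product l s ih =>
    let T : (∀ i, HMillModel.realizable σ (s i)) →ₗ[ℝ] C(∀ i, (s i).space, ℝ) :=
      { toFun g := ⟨fun x => ∑ i, (g i).1 (x i), by fun_prop⟩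
        map_add' f g := by ext x; simp [Finset.sum_add_distrib]
        map_smul' c g := by ext x; simp [Finset.mul_sum] }
    refine Submodule.topologicalClosure_eq_top_of_comp_mem hσ (V := LinearMap.range T)
      (fun x y hxy => ?_) ?_
    · obtain ⟨i, hi⟩ := Function.ne_iff.1 hxy
      obtain ⟨f, hf, hne⟩ := ContinuousMap.exists_apply_ne_of_dense
        (Submodule.dense_iff_topologicalClosure_eq_top.2 (ih i)) hi
      -- Zero summands elsewhere leave a function of coordinate `i` alone.
      refine ⟨_, ⟨Pi.single i ⟨f, hf⟩, rfl⟩, ?_⟩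
      have h (z : ∀ i, (s i).space) : T (Pi.single i ⟨f, hf⟩) z = f (z i) := by
        refine (Fintype.sum_eq_single i fun j hj => ?_).trans ?_
        · simp [Pi.single_eq_of_ne hj]
        · simp
      rwa [h, h]
    · rintro _ ⟨g, rfl⟩ b
      choose M hM using fun i => (g i).2
      refine ⟨.product M (.neuron 1 b), ContinuousMap.ext fun x => ?_⟩
      refine (Network.neuron_eval 1 b σ _ 0).trans (congrArg σ ?_)
      simp only [Pi.one_apply, one_mul, Fintype.sum_sigma, Finset.univ_unique, Finset.sum_singleton]
      refine (add_comm _ _).trans (congrArg (· + b) (Finset.sum_congr rfl fun i _ => ?_))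
      exact DFunLike.congr_fun (hM i) (x i)
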